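/- Let $n\ge 0$ and let $I,\overline J$ be nonempty subsets of $[n]=\{0,\dots,n\}$ and of a second copy $[\overline n]=\{\overline 0,\dots,\overline n\}$ of it. Two arcs $(i,\overline j),(i',\overline{j'})\in I\times\overline J$ *cyclically cross* if $$j-i'<j-i\ \text{ and }\ j-i'<j'-i',\qquad\text{or}\qquad j'-i<j-i\ \text{ and }\ j'-i<j'-i',$$ where all differences are reduced modulo $n+1$ to representatives in $\{0,\dots,n\}$ before being compared. A *cyclic $(I,\overline J)$-tree* is an inclusion-maximal set of pairwise cyclically non-crossing arcs in $I\times\overline J$. The *$(I,\overline J)$-cyclohedral triangulation* $\mathcal C_{I,\overline J}$ is the triangulation of the product of simplices $\Delta_I\times\Delta_{\overline J}=\operatorname{conv}\{(\mathbf e_i,\mathbf e_{\overline j}) : i\in I,\ \overline j\in\overline J\}\subset\mathbb R^{n+1}\times\mathbb R^{n+1}$ whose maximal simplices are $\operatorname{conv}\{(\mathbf e_i,\mathbf e_{\overline j}) : (i,\overline j)\in T\}$, where $T$ ranges over the cyclic $(I,\overline J)$-trees. For a finite simplicial complex $K$ of dimension $d-1$ with $f_{i-1}$ faces with $i$ vertices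 (so $f_{-1}=1$), the $h$-vector is defined by $\sum_{i=0}^{d} f_{i-1}(x-1)^{d-i}=\sum_{k=0}^{d}h_k(K)\,x^{d-k}$, and $h_k(K)=0$ for $k>d$. **Theorem.** For every $k\ge 0$, $$h_k(\mathcal C_{I,\overline J})=\binom{|I|-1}{k}\binom{|\overline J|-1}{k}.$$ In particular, if $|I|=mr+1$ and $|\overline J|=r+1$ for integers $m,r\ge 0$, then $h_k(\mathcal C_{I,\overline J})=\binom{mr}{k}\binom{r}{k}$ for every $k\ge 0$, the Fuss–Catalan analogue of the Narayana numbers of type $B_r$ (which are $\binom{r}{k}^2$, the case $m=1$). -/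

import Mathlib

open Finset

/-- The index set of the arcs `(i, j̄)` of the complete bipartite graph with node sets
`[n] = {0, …, n}` and `[n̄] = {0̄, …, n̄}`. -/
abbrev Arc (n : ℕ) : Type := Fin (n + 1) × Fin (n + 1)

/-- Two arcs `a = (i, j̄)` and `b = (i', j̄')` cyclically cross. Subtraction in `Fin (n + 1)` is
subtraction modulo `n + 1`, and `<` compares the representatives in `{0, …, n}`. -/
def CyclicallyCross {n : ℕ} (a b : Arc n) : Prop :=
  (a.2 - b.1 < a.2 - a.1 ∧ a.2 - b.1 < b.2 - b.1) ∨
  (b.2 - a.1 < a.2 - a.1 ∧ b.2 - a.1 < b.2 - b.1)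

/-- A cyclic `(I, J̄)`-forest: a cyclically non-crossing subgraph (given by its set of arcs)
of the complete bipartite graph on `I ⊔ J̄`. -/
def IsCyclicForest {n : ℕ} (I J : Finset (Fin (n + 1))) (F : Finset (Arc n)) : Prop :=
  F ⊆ I ×ˢ J ∧ ∀ a ∈ F, ∀ b ∈ F, ¬ CyclicallyCross a b

/-- A cyclic `(I, J̄)`-tree: a maximal cyclic `(I, J̄)`-forest. -/
def IsCyclicTree {n : ℕ} (I J : Finset (Fin (n + 1))) (T : Finset (Arc n)) : Prop :=
  Maximal (IsCyclicForest I J) T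

/-- The Euclidean space `ℝ^(n+1) × ℝ^(n+1)` that contains the products of simplices. -/
abbrev ProdSpace (n : ℕ) : Type := (Fin (n + 1) → ℝ) × (Fin (n + 1) → ℝ)

/-- The point `(e_i, e_j̄)` that corresponds to the arc `(i, j̄)`. -/
def arcPoint {n : ℕ} (a : Arc n) : ProdSpace n := (Pi.single a.1 1, Pi.single a.2 1)

/-- The polytope `Δ_I × Δ_J̄ = conv {(e_i, e_j̄) : i ∈ I, j̄ ∈ J̄}`. -/
def simplexProd {n : ℕ} (I J : Finset (Fin (n + 1))) : Set (ProdSpace n) :=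
  convexHull ℝ (arcPoint '' (I ×ˢ J : Set (Arc n)))

/-- A triangulation of a polytope `P`: a collection of simplices that are spanned by vertices of
`P`, intersect properly and cover `P`. As in Mathlib, a simplex is given by its vertex set. -/
structure Triangulation {E : Type*} [AddCommGroup E] [Module ℝ E] (P : Set E)
    extends Geometry.SimplicialComplex ℝ E where
  subset_extremePoints : ∀ s ∈ faces, (s : Set E) ⊆ P.extremePoints ℝ
  space_eq : toSimplicialComplex.space = P

theorem arcPoint_injective {n : ℕ} : Function.Injective (arcPoint (n := n)) := by
  rintro ⟨i, j⟩ ⟨i', j'⟩ h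
  simp only [arcPoint, Prod.mk.injEq] at h
  have h1 := congrFun h.1 i
  have h2 := congrFun h.2 j
  simp only [Pi.single_apply, if_true] at h1 h2
  ext1
  · by_contra hne
    simp [show ¬ (i = i') from hne] at h1
  · by_contra hne
    simp [show ¬ (j = j') from hne] at h2

theorem sum_arcPoint_fst {n : ℕ} (w : Arc n → ℝ) (i : Fin (n + 1)) :
    (∑ a, w a • arcPoint a).1 i = ∑ j, w (i, j) := by
  simp [Prod.fst_sum, arcPoint, Fintype.sum_prod_type_right, Pi.single_apply]

theorem sum_arcPoint_snd {n : ℕ} (w : Arc n → ℝ) (j : Fin (n + 1)) :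
    (∑ a, w a • arcPoint a).2 j = ∑ i, w (i, j) := by
  simp [Prod.snd_sum, arcPoint, Fintype.sum_prod_type, Pi.single_apply]

theorem weights_le_of_nonCrossing {n : ℕ} (w u : Arc n → ℝ) (hw : ∀ a, 0 ≤ w a)
    (cu : ∀ a b, u a ≠ 0 → u b ≠ 0 → ¬ CyclicallyCross a b)
    (h : ∑ a, w a • arcPoint a = ∑ a, u a • arcPoint a) (a : Arc n)
    (ih : ∀ b : Arc n, b.2 - b.1 < a.2 - a.1 → w b = u b) : w a ≤ u a := by
  obtain ⟨i, j⟩ := a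
  by_contra hlt
  push Not at hlt
  have h1 : ∑ y, w (i, y) = ∑ y, u (i, y) := by
    rw [← sum_arcPoint_fst, ← sum_arcPoint_fst, h]
  have h2 : ∑ x, w (x, j) = ∑ x, u (x, j) := by
    rw [← sum_arcPoint_snd, ← sum_arcPoint_snd, h]
  obtain ⟨j', hj'⟩ : ∃ y, w (i, y) < u (i, y) := by
    by_contra! hc
    exact (Finset.sum_lt_sum (fun y _ => hc y) ⟨j, mem_univ _, hlt⟩).ne' h1
  obtain ⟨i', hi'⟩ : ∃ x, w (x, j) < u (x, j) := by
    by_contra! hc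
    exact (Finset.sum_lt_sum (fun x _ => hc x) ⟨i, mem_univ _, hlt⟩).ne' h2
  have hjj : j' ≠ j := fun e => by subst e; exact absurd hlt hj'.not_gt
  have hii : i' ≠ i := fun e => by subst e; exact absurd hlt hi'.not_gt
  have l1 : j - i < j' - i := by
    refine lt_of_le_of_ne (not_lt.1 fun hc => hj'.ne (ih (i, j') hc)) fun e => hjj ?_
    exact (sub_left_inj.1 e).symm
  have l2 : j - i < j - i' := by
    refine lt_of_le_of_ne (not_lt.1 fun hc => hi'.ne (ih (i', j) hc)) fun e => hii ?_
    exact (sub_right_inj.1 e).symm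
  exact cu (i', j) (i, j') ((hw _).trans_lt hi').ne' ((hw _).trans_lt hj').ne' (Or.inl ⟨l2, l1⟩)

/-- A point has at most one representation as a nonnegative combination supported on a cyclically
non-crossing set of arcs. -/
theorem weights_unique {n : ℕ} (w u : Arc n → ℝ) (hw : ∀ a, 0 ≤ w a) (hu : ∀ a, 0 ≤ u a)
    (cw : ∀ a b, w a ≠ 0 → w b ≠ 0 → ¬ CyclicallyCross a b)
    (cu : ∀ a b, u a ≠ 0 → u b ≠ 0 → ¬ CyclicallyCross a b)
    (h : ∑ a, w a • arcPoint a = ∑ a, u a • arcPoint a) : w = u := by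
  have key : ∀ m : ℕ, ∀ a : Arc n, (a.2 - a.1).val = m → w a = u a := by
    intro m
    induction m using Nat.strong_induction_on with
    | _ m ih =>
      intro a ha
      have ih' : ∀ b : Arc n, b.2 - b.1 < a.2 - a.1 → w b = u b := fun b hb =>
        ih _ (by rw [← ha]; exact hb) b rfl
      exact le_antisymm (weights_le_of_nonCrossing w u hw cu h a ih')
        (weights_le_of_nonCrossing u w hu cw h.symm a fun b hb => (ih' b hb).symm)
  funext a
  exact key _ a rfl

/-- Every pair of nonnegative marginals with equal totals is realized by nonnegative weights on a
cyclically non-crossing set of arcs. -/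
theorem weights_exist {n : ℕ} (m : ℕ) :
    ∀ (r c : Fin (n + 1) → ℝ), (∀ i, 0 ≤ r i) → (∀ j, 0 ≤ c j) →
    ∑ i, r i = ∑ j, c j → #{i | r i ≠ 0} + #{j | c j ≠ 0} = m →
    ∃ w : Arc n → ℝ, (∀ a, 0 ≤ w a) ∧ (∀ a, w a ≠ 0 → r a.1 ≠ 0 ∧ c a.2 ≠ 0) ∧
      (∀ a b, w a ≠ 0 → w b ≠ 0 → ¬ CyclicallyCross a b) ∧
      (∀ i, ∑ j, w (i, j) = r i) ∧ (∀ j, ∑ i, w (i, j) = c j) := by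
  induction m using Nat.strong_induction_on with
  | _ m ih =>
    intro r c hr hc hrc hm
    by_cases hz : ∀ i, r i = 0
    · have hc0 : ∀ j, c j = 0 := by
        have : ∑ j, c j = 0 := by rw [← hrc]; simp [hz]
        intro j
        exact (Finset.sum_eq_zero_iff_of_nonneg fun j _ => hc j).1 this j (mem_univ _)
      exact ⟨fun _ => 0, by simp, by simp, by simp, by simp [hz], by simp [hc0]⟩
    push Not at hz
    obtain ⟨i₀, hi₀⟩ := hz
    obtain ⟨j₀, hj₀⟩ : ∃ j, c j ≠ 0 := by
      by_contra! hc0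
      have : ∑ i, r i = 0 := by rw [hrc]; simp [hc0]
      exact hi₀ ((Finset.sum_eq_zero_iff_of_nonneg fun i _ => hr i).1 this i₀ (mem_univ _))
    obtain ⟨⟨i, j⟩, hmem, hmin⟩ := Finset.exists_min_image
      (Finset.univ.filter fun a : Arc n => r a.1 ≠ 0 ∧ c a.2 ≠ 0) (fun a => a.2 - a.1)
      ⟨(i₀, j₀), by simp [hi₀, hj₀]⟩
    simp only [mem_filter, mem_univ, true_and] at hmem hmin
    set t := min (r i) (c j) with ht
    have htr : t ≤ r i := min_le_left _ _
    have htc : t ≤ c j := min_le_right _ _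
    have ht0 : 0 ≤ t := le_min (hr i) (hc j)
    set r' : Fin (n + 1) → ℝ := fun x => r x - if x = i then t else 0 with hr'
    set c' : Fin (n + 1) → ℝ := fun y => c y - if y = j then t else 0 with hc'
    have sr : ∀ x, r' x ≠ 0 → r x ≠ 0 := by
      intro x hx h0
      by_cases hxi : x = i
      · subst hxi; exact hmem.1 h0
      · simp [hr', hxi, h0] at hx
    have sc : ∀ y, c' y ≠ 0 → c y ≠ 0 := by
      intro y hy h0
      by_cases hyj : y = j
      · subst hyj; exact hmem.2 h0
      · simp [hc', hyj, h0] at hy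
    have subr : (Finset.univ.filter fun x => r' x ≠ 0) ⊆ Finset.univ.filter fun x => r x ≠ 0 := by
      intro x; simpa using sr x
    have subc : (Finset.univ.filter fun x => c' x ≠ 0) ⊆ Finset.univ.filter fun x => c x ≠ 0 := by
      intro x; simpa using sc x
    have hlt : #{x | r' x ≠ 0} + #{y | c' y ≠ 0} < m := by
      rw [← hm]
      rcases min_choice (r i) (c j) with e | e
      · refine add_lt_add_of_lt_of_le (Finset.card_lt_card ?_) (Finset.card_le_card subc)
        refine ⟨subr, fun hs => ?_⟩
        have := hs (show i ∈ _ by simpa using hmem.1)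
        simp [hr', ht, e] at this
      · refine add_lt_add_of_le_of_lt (Finset.card_le_card subr) (Finset.card_lt_card ?_)
        refine ⟨subc, fun hs => ?_⟩
        have := hs (show j ∈ _ by simpa using hmem.2)
        simp [hc', ht, e] at this
    obtain ⟨w, w0, ws, wc, wr, wcol⟩ := ih _ hlt r' c'
      (fun x => by
        by_cases hx : x = i
        · subst hx; simpa [hr'] using htr
        · simpa [hr', hx] using hr x)
      (fun y => by
        by_cases hy : y = j
        · subst hy; simpa [hc'] using htc
        · simpa [hc', hy] using hc y)
      (by simp [hr', hc', Finset.sum_sub_distrib, hrc]) rfl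
    have supp : ∀ a, w a + (if a = (i, j) then t else 0) ≠ 0 → a = (i, j) ∨ w a ≠ 0 := by
      intro a ha
      by_cases e : a = (i, j)
      · exact Or.inl e
      · right; simpa [e] using ha
    have supp' : ∀ a, w a + (if a = (i, j) then t else 0) ≠ 0 → r a.1 ≠ 0 ∧ c a.2 ≠ 0 := by
      intro a ha
      rcases supp a ha with rfl | h
      · exact hmem
      · exact ⟨sr _ (ws a h).1, sc _ (ws a h).2⟩
    refine ⟨fun a => w a + if a = (i, j) then t else 0, ?_, supp', ?_, ?_, ?_⟩
    · intro a
      have := w0 a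
      dsimp only
      split_ifs <;> linarith
    · intro a b ha hb hab
      have ga := supp' a ha
      have gb := supp' b hb
      rcases supp a ha with rfl | ha'
      · rcases hab with h | h
        · exact absurd h.1 (not_lt.2 (hmin (b.1, j) ⟨gb.1, hmem.2⟩))
        · exact absurd h.1 (not_lt.2 (hmin (i, b.2) ⟨hmem.1, gb.2⟩))
      · rcases supp b hb with rfl | hb'
        · rcases hab with h | h
          · exact absurd h.2 (not_lt.2 (hmin (i, a.2) ⟨hmem.1, ga.2⟩))
          · exact absurd h.2 (not_lt.2 (hmin (a.1, j) ⟨ga.1, hmem.2⟩))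
        · exact wc a b ha' hb' hab
    · intro x
      rw [Finset.sum_add_distrib, wr x]
      by_cases hx : x = i <;> simp [hr', hx]
    · intro y
      rw [Finset.sum_add_distrib, wcol y]
      by_cases hy : y = j <;> simp [hc', hy]

theorem mem_convexHull_arcPoint {n : ℕ} (F : Finset (Arc n)) (x : ProdSpace n) :
    x ∈ convexHull ℝ (arcPoint '' (F : Set (Arc n))) ↔
      ∃ w : Arc n → ℝ, (∀ a, 0 ≤ w a) ∧ (∀ a, w a ≠ 0 → a ∈ F) ∧ ∑ a, w a = 1 ∧
        ∑ a, w a • arcPoint a = x := by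
  classical
  constructor
  · intro hx
    rw [← Finset.coe_image, Finset.mem_convexHull'] at hx
    obtain ⟨v, v0, v1, vx⟩ := hx
    rw [Finset.sum_image fun a _ b _ h => arcPoint_injective h] at v1 vx
    refine ⟨fun a => if a ∈ F then v (arcPoint a) else 0, fun a => ?_, fun a ha => ?_, ?_, ?_⟩
    · dsimp only
      split_ifs with h
      · exact v0 _ (mem_image_of_mem _ h)
      · exact le_rfl
    · by_contra h
      simp [h] at ha
    · simpa using v1
    · simpa [ite_smul] using vx
  · rintro ⟨w, w0, wF, w1, rfl⟩
    have e : ∀ a ∉ F, w a = 0 := fun a ha => by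
      by_contra h
      exact ha (wF a h)
    rw [← Finset.sum_subset (subset_univ F) fun a _ ha => e a ha] at w1
    rw [← Finset.sum_subset (subset_univ F) fun a _ ha => by rw [e a ha, zero_smul]]
    exact (convex_convexHull ℝ _).sum_mem (fun a _ => w0 a) w1
      fun a ha => subset_convexHull ℝ _ ⟨a, ha, rfl⟩

theorem IsCyclicForest.affineIndependent {n : ℕ} {I J : Finset (Fin (n + 1))} {F : Finset (Arc n)}
    (hF : IsCyclicForest I J F) :
    AffineIndependent ℝ ((↑) : (arcPoint '' (F : Set (Arc n)) : Set (ProdSpace n)) →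
      ProdSpace n) := by
  classical
  have hli : LinearIndependent ℝ fun a : F => arcPoint (a : Arc n) := by
    rw [Fintype.linearIndependent_iff]
    intro g hg
    set w : Arc n → ℝ := fun a => if h : a ∈ F then g ⟨a, h⟩ else 0 with hw
    have wF : ∀ a, w a ≠ 0 → a ∈ F := fun a ha => by
      by_contra h
      simp [hw, h] at ha
    have hsum : ∑ a, w a • arcPoint a = 0 := by
      rw [← hg, ← Finset.sum_subset (subset_univ F), ← Finset.sum_coe_sort F]
      · exact Finset.sum_congr rfl fun a _ => by simp [hw]
      · intro a _ ha
        simp [hw, ha]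
    have huniq := weights_unique (fun a => max (w a) 0) (fun a => max (-w a) 0)
      (fun a => le_max_right _ _) (fun a => le_max_right _ _)
      (fun a b ha hb => hF.2 a (wF a fun h => by simp [h] at ha) b (wF b fun h => by simp [h] at hb))
      (fun a b ha hb => hF.2 a (wF a fun h => by simp [h] at ha) b (wF b fun h => by simp [h] at hb))
      (by
        rw [← sub_eq_zero, ← Finset.sum_sub_distrib, ← hsum]
        refine Finset.sum_congr rfl fun a _ => ?_
        rw [← sub_smul]
        congr 1
        rcases le_total (w a) 0 with h | h
        · rw [max_eq_right h, max_eq_left (by linarith)]; ring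
        · rw [max_eq_left h, max_eq_right (by linarith)]; ring)
    intro a
    have := congrFun huniq (a : Arc n)
    have hwa : w a = g a := by simp [hw]
    rw [← hwa]
    rcases le_total (w a) 0 with h | h
    · rw [max_eq_right h, max_eq_left (by linarith)] at this; linarith
    · rw [max_eq_left h, max_eq_right (by linarith)] at this; linarith
  have := hli.affineIndependent.range
  have e : Set.range (fun a : F => arcPoint (a : Arc n)) = arcPoint '' (F : Set (Arc n)) := by
    ext x; simp
  rwa [e] at this

theorem arcPoint_mem_extremePoints {n : ℕ} {I J : Finset (Fin (n + 1))} {a : Arc n}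
    (ha : a ∈ I ×ˢ J) : arcPoint a ∈ (simplexProd I J).extremePoints ℝ := by
  have box : ∀ x ∈ simplexProd I J, (∀ i, 0 ≤ x.1 i ∧ x.1 i ≤ 1) ∧ ∀ j, 0 ≤ x.2 j ∧ x.2 j ≤ 1 := by
    intro x hx
    rw [simplexProd, ← Finset.coe_product, mem_convexHull_arcPoint] at hx
    obtain ⟨w, w0, -, w1, rfl⟩ := hx
    rw [Fintype.sum_prod_type] at w1
    refine ⟨fun i => ?_, fun j => ?_⟩
    · rw [sum_arcPoint_fst, ← w1]
      exact ⟨Finset.sum_nonneg fun _ _ => w0 _, Finset.single_le_sum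
        (f := fun i => ∑ j, w (i, j)) (fun _ _ => Finset.sum_nonneg fun _ _ => w0 _) (mem_univ i)⟩
    · rw [sum_arcPoint_snd, ← w1, Finset.sum_comm]
      exact ⟨Finset.sum_nonneg fun _ _ => w0 _, Finset.single_le_sum
        (f := fun j => ∑ i, w (i, j)) (fun _ _ => Finset.sum_nonneg fun _ _ => w0 _) (mem_univ j)⟩
  have scal : ∀ p q s t v : ℝ, 0 ≤ p → p ≤ 1 → 0 ≤ q → q ≤ 1 → 0 < s → 0 < t → s + t = 1 →
      s * p + t * q = v → (v = 0 ∨ v = 1) → p = v := by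
    intro p q s t v p0 p1 q0 q1 s0 t0 st e hv
    rcases hv with rfl | rfl
    · have h1 := mul_nonneg s0.le p0
      have h2 := mul_nonneg t0.le q0
      have h3 : s * p = 0 := by linarith
      exact (mul_eq_zero.1 h3).resolve_left s0.ne'
    · have h1 := mul_nonneg s0.le (sub_nonneg.2 p1)
      have h2 := mul_nonneg t0.le (sub_nonneg.2 q1)
      have h3 : s * (1 - p) = 0 := by nlinarith
      have := (mul_eq_zero.1 h3).resolve_left s0.ne'
      linarith
  have sing : ∀ i k : Fin (n + 1), (Pi.single i 1 : Fin (n + 1) → ℝ) k = 0 ∨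
      (Pi.single i 1 : Fin (n + 1) → ℝ) k = 1 := by
    intro i k
    by_cases h : k = i <;> simp [h]
  rw [mem_extremePoints_iff_left]
  refine ⟨subset_convexHull ℝ _ ⟨a, by simpa using ha, rfl⟩, ?_⟩
  rintro x hx y hy ⟨s, t, s0, t0, st, e⟩
  have bx := box x hx
  have bY := box y hy
  refine Prod.ext (funext fun i => ?_) (funext fun j => ?_)
  · have e1 := congrFun (congrArg Prod.fst e) i
    exact scal _ (y.1 i) s t _ (bx.1 i).1 (bx.1 i).2 (bY.1 i).1 (bY.1 i).2 s0 t0 st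
      (by simpa using e1) (sing a.1 i)
  · have e1 := congrFun (congrArg Prod.snd e) j
    exact scal _ (y.2 j) s t _ (bx.2 j).1 (bx.2 j).2 (bY.2 j).1 (bY.2 j).2 s0 t0 st
      (by simpa using e1) (sing a.2 j)

theorem IsCyclicForest.exists_tree {n : ℕ} {I J : Finset (Fin (n + 1))} {F : Finset (Arc n)}
    (hF : IsCyclicForest I J F) : ∃ T, IsCyclicTree I J T ∧ F ⊆ T := by
  obtain ⟨T, h1, h2⟩ := (Set.toFinite {F : Finset (Arc n) | IsCyclicForest I J F}).exists_le_maximal hF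
  exact ⟨T, h2, h1⟩

/-- The `(I, J̄)`-cyclohedral triangulation of `Δ_I × Δ_J̄`: its maximal simplices are
`conv {(e_i, e_j̄) : (i, j̄) ∈ T}` for the cyclic `(I, J̄)`-trees `T`, and its simplices are the
nonempty faces of these. -/
def cyclohedralTriangulation {n : ℕ} (I J : Finset (Fin (n + 1))) :
    Triangulation (simplexProd I J) where
  faces := {s | s.Nonempty ∧ ∃ T, IsCyclicTree I J T ∧
    (s : Set (ProdSpace n)) ⊆ arcPoint '' (T : Set (Arc n))}
  isRelLowerSet_faces := fun _ hs =>
    ⟨hs.1, fun _ hts ht => ⟨ht, hs.2.imp fun _ hT => ⟨hT.1, (Finset.coe_subset.2 hts).trans hT.2⟩⟩⟩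
  indep := by
    rintro s ⟨-, T, hT, hsT⟩
    exact hT.prop.affineIndependent.mono hsT
  inter_subset_convexHull := by
    rintro s t ⟨-, T, hT, hsT⟩ ⟨-, T', hT', htT⟩ x ⟨hxs, hxt⟩
    classical
    obtain ⟨F, hFT, rfl⟩ := Finset.subset_set_image_iff.1 hsT
    obtain ⟨G, hGT, rfl⟩ := Finset.subset_set_image_iff.1 htT
    rw [Finset.coe_image, mem_convexHull_arcPoint] at hxs hxt
    obtain ⟨w, w0, wF, w1, wx⟩ := hxs
    obtain ⟨u, u0, uG, u1, ux⟩ := hxt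
    have := weights_unique w u w0 u0
      (fun a b ha hb => hT.prop.2 a (hFT (wF a ha)) b (hFT (wF b hb)))
      (fun a b ha hb => hT'.prop.2 a (hGT (uG a ha)) b (hGT (uG b hb))) (wx.trans ux.symm)
    subst this
    rw [Finset.coe_image, Finset.coe_image, ← Set.image_inter arcPoint_injective,
      ← Finset.coe_inter, mem_convexHull_arcPoint]
    exact ⟨w, w0, fun a ha => mem_inter.2 ⟨wF a ha, uG a ha⟩, w1, wx⟩
  subset_extremePoints := by
    rintro s ⟨-, T, hT, hsT⟩ x hx
    obtain ⟨a, ha, rfl⟩ := hsT hx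
    exact arcPoint_mem_extremePoints (hT.prop.1 ha)
  space_eq := by
    classical
    ext x
    rw [Geometry.SimplicialComplex.mem_space_iff]
    constructor
    · rintro ⟨s, ⟨-, T, hT, hsT⟩, hx⟩
      refine convexHull_mono (hsT.trans (Set.image_mono ?_)) hx
      rw [← Finset.coe_product]
      exact Finset.coe_subset.2 hT.prop.1
    · intro hx
      rw [simplexProd, ← Finset.coe_product, mem_convexHull_arcPoint] at hx
      obtain ⟨u, u0, uI, u1, rfl⟩ := hx
      obtain ⟨w, w0, ws, wc, wr, wcol⟩ := weights_exist _ (fun i => ∑ j, u (i, j))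
        (fun j => ∑ i, u (i, j)) (fun _ => Finset.sum_nonneg fun _ _ => u0 _)
        (fun _ => Finset.sum_nonneg fun _ _ => u0 _) Finset.sum_comm rfl
      have hF : IsCyclicForest I J (Finset.univ.filter fun a => w a ≠ 0) := by
        refine ⟨fun a ha => ?_, fun a ha b hb => wc a b (by simpa using ha) (by simpa using hb)⟩
        obtain ⟨h1, h2⟩ := ws a (by simpa using ha)
        obtain ⟨y, -, hy⟩ := Finset.exists_ne_zero_of_sum_ne_zero h1
        obtain ⟨z, -, hz⟩ := Finset.exists_ne_zero_of_sum_ne_zero h2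
        exact mem_product.2 ⟨(mem_product.1 (uI _ hy)).1, (mem_product.1 (uI _ hz)).2⟩
      have hw1 : ∑ a, w a = 1 := by
        rw [← u1, Fintype.sum_prod_type, Fintype.sum_prod_type]
        exact Finset.sum_congr rfl fun i _ => wr i
      obtain ⟨T, hT, hFT⟩ := hF.exists_tree
      refine ⟨(Finset.univ.filter fun a => w a ≠ 0).image arcPoint, ⟨?_, T, hT, ?_⟩, ?_⟩
      · obtain ⟨a, -, ha⟩ := Finset.exists_ne_zero_of_sum_ne_zero (hw1.trans_ne one_ne_zero)
        exact ⟨arcPoint a, mem_image_of_mem _ (by simpa using ha)⟩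
      · rw [Finset.coe_image]
        exact Set.image_mono (Finset.coe_subset.2 hFT)
      · rw [Finset.coe_image, mem_convexHull_arcPoint]
        refine ⟨w, w0, fun a ha => by simpa using ha, hw1, ?_⟩
        refine Prod.ext (funext fun i => ?_) (funext fun j => ?_)
        · rw [sum_arcPoint_fst, sum_arcPoint_fst, wr]
        · rw [sum_arcPoint_snd, sum_arcPoint_snd, wcol]

namespace Geometry.SimplicialComplex

variable {E : Type*} [AddCommGroup E] [Module ℝ E]

/-- `K.numFaces i = f_{i-1}(K)`: the number of faces with `i` vertices of a finite simplicial
complex, including the empty face for `i = 0` (Mathlib's `faces` leaves it out). -/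
noncomputable def numFaces (K : SimplicialComplex ℝ E) (i : ℕ) : ℕ :=
  {s : Finset E | (s = ∅ ∨ s ∈ K.faces) ∧ s.card = i}.ncard

/-- The largest number of vertices of a face of a finite simplicial complex, that is,
one more than its dimension. -/
noncomputable def rank (K : SimplicialComplex ℝ E) : ℕ :=
  sSup (Finset.card '' K.faces)

/-- The `h`-vector of a finite simplicial complex of dimension `d - 1`:
`h_k = ∑_{i=0}^{k} (-1)^(k-i) * C(d-i, k-i) * f_{i-1}`, that is, `∑_i f_{i-1} (x-1)^(d-i) =
∑_k h_k x^(d-k)`. All the entries with `k > d` are zero. -/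
noncomputable def hVector (K : SimplicialComplex ℝ E) (k : ℕ) : ℤ :=
  ∑ i ∈ Finset.range (k + 1),
    (-1) ^ (k - i) * ((K.rank - i).choose (k - i) : ℤ) * (K.numFaces i : ℤ)

end Geometry.SimplicialComplex

/-! The proof counts the lattice points of the dilates of Δ_I × Δ_J̄ in two ways. Put a = |I| - 1
and b = |J̄| - 1.

A lattice point of the `t`-th dilate is a pair of natural marginals of total `t`, supported on `I`
and `J`. It is realized by exactly one natural weight whose support is cyclically non-crossing
(`natWeights_exist`, `natWeights_unique`); this is the unimodularity of the triangulation. Sorting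
the lattice points by the support F of this weight (`sum_card_weights_cyclicForests`) writes the
Ehrhart series as ∑_F (X/(1-X))^|F| over all cyclic forests F, that is, as P/(1-X)^d, where P = ∑
h_k X^k and d is the rank of the complex.

Counting the marginals directly gives C(a+t, a) C(b+t, b) points, with series Q/(1-X)^(a+b+1) for Q
= ∑ C(a,k) C(b,k) X^k (`one_sub_X_pow_mul_mk_choose`).

Hence P (1-X)^(a+b+1) = Q (1-X)^d. Neither P nor Q vanishes at 1, so d = a + b + 1 and P = Q. The
dimension thus comes out of the comparison and is not computed from the geometry. -/

/-! ### Lattice points and cyclic forests -/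

/-- Every pair of natural marginals with equal totals is realized by natural weights on a
cyclically non-crossing set of arcs. -/
theorem natWeights_exist {n : ℕ} (t : ℕ) : ∀ r c : Fin (n + 1) → ℕ,
    ∑ i, r i = t → ∑ j, c j = t →
    ∃ w : Arc n → ℕ, (∀ a, w a ≠ 0 → r a.1 ≠ 0 ∧ c a.2 ≠ 0) ∧
      (∀ a b, w a ≠ 0 → w b ≠ 0 → ¬ CyclicallyCross a b) ∧
      (∀ i, ∑ j, w (i, j) = r i) ∧ (∀ j, ∑ i, w (i, j) = c j) := by
  induction t with
  | zero =>
    intro r c hr hc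
    simp only [Finset.sum_eq_zero_iff, mem_univ, true_imp_iff] at hr hc
    exact ⟨0, by simp, by simp, by simp [hr], by simp [hc]⟩
  | succ t ih =>
    intro r c hr hc
    obtain ⟨i₀, -, hi₀⟩ := Finset.exists_ne_zero_of_sum_ne_zero (hr.trans_ne t.succ_ne_zero)
    obtain ⟨j₀, -, hj₀⟩ := Finset.exists_ne_zero_of_sum_ne_zero (hc.trans_ne t.succ_ne_zero)
    -- Greedy choice: put one unit on an arc of least cyclic length among those with both ends in
    -- the supports. If two arcs cross, one of the two arcs obtained by exchanging their ends is
    -- strictly shorter than both, so no arc between the supports crosses this one.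
    obtain ⟨⟨i, j⟩, hmem, hmin⟩ := Finset.exists_min_image
      (Finset.univ.filter fun a : Arc n => r a.1 ≠ 0 ∧ c a.2 ≠ 0) (fun a => a.2 - a.1)
      ⟨(i₀, j₀), by simp [hi₀, hj₀]⟩
    simp only [mem_filter, mem_univ, true_and] at hmem hmin
    have split : ∀ (f : Fin (n + 1) → ℕ) (x : Fin (n + 1)), f x ≠ 0 → ∑ y, f y = t + 1 →
        ∃ f' : Fin (n + 1) → ℕ, (∀ y, f y = f' y + if y = x then 1 else 0) ∧ ∑ y, f' y = t := by
      intro f x hx hf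
      have hsplit : ∀ y, f y = (f y - if y = x then 1 else 0) + if y = x then 1 else 0 := by
        intro y
        split_ifs with h
        · subst h; omega
        · rfl
      refine ⟨_, hsplit, ?_⟩
      rw [Finset.sum_congr rfl fun y _ => hsplit y, Finset.sum_add_distrib] at hf
      simpa using hf
    obtain ⟨r', er, hr'⟩ := split r i hmem.1 hr
    obtain ⟨c', ec, hc'⟩ := split c j hmem.2 hc
    obtain ⟨w, ws, wc, wr, wcol⟩ := ih r' c' hr' hc'
    have supp : ∀ a, w a + (if a = (i, j) then 1 else 0) ≠ 0 → a = (i, j) ∨ w a ≠ 0 := by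
      intro a ha
      by_cases e : a = (i, j)
      · exact Or.inl e
      · right; simpa [e] using ha
    have supp' : ∀ a, w a + (if a = (i, j) then 1 else 0) ≠ 0 → r a.1 ≠ 0 ∧ c a.2 ≠ 0 := by
      intro a ha
      rcases supp a ha with rfl | h
      · exact hmem
      · have := ws a h
        have h1 := er a.1
        have h2 := ec a.2
        omega
    refine ⟨fun a => w a + if a = (i, j) then 1 else 0, supp', ?_, ?_, ?_⟩
    · intro a b ha hb hab
      have ga := supp' a ha
      have gb := supp' b hb
      rcases supp a ha with rfl | ha'
      · rcases hab with h | h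
        · exact absurd h.1 (not_lt.2 (hmin (b.1, j) ⟨gb.1, hmem.2⟩))
        · exact absurd h.1 (not_lt.2 (hmin (i, b.2) ⟨hmem.1, gb.2⟩))
      · rcases supp b hb with rfl | hb'
        · rcases hab with h | h
          · exact absurd h.2 (not_lt.2 (hmin (i, a.2) ⟨hmem.1, ga.2⟩))
          · exact absurd h.2 (not_lt.2 (hmin (a.1, j) ⟨ga.1, hmem.2⟩))
        · exact wc a b ha' hb' hab
    · intro x
      rw [Finset.sum_add_distrib, wr x, er x]
      by_cases hx : x = i <;> simp [hx]
    · intro y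
      rw [Finset.sum_add_distrib, wcol y, ec y]
      by_cases hy : y = j <;> simp [hy]

/-- Natural weights on a cyclically non-crossing set of arcs are determined by their marginals. -/
theorem natWeights_unique {n : ℕ} (w u : Arc n → ℕ)
    (cw : ∀ a b, w a ≠ 0 → w b ≠ 0 → ¬ CyclicallyCross a b)
    (cu : ∀ a b, u a ≠ 0 → u b ≠ 0 → ¬ CyclicallyCross a b)
    (h1 : ∀ i, ∑ j, w (i, j) = ∑ j, u (i, j)) (h2 : ∀ j, ∑ i, w (i, j) = ∑ i, u (i, j)) :
    w = u := by
  have := weights_unique (fun a => (w a : ℝ)) (fun a => (u a : ℝ)) (fun _ => Nat.cast_nonneg _)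
    (fun _ => Nat.cast_nonneg _)
    (fun a b ha hb => cw a b (Nat.cast_ne_zero.1 ha) (Nat.cast_ne_zero.1 hb))
    (fun a b ha hb => cu a b (Nat.cast_ne_zero.1 ha) (Nat.cast_ne_zero.1 hb))
    (by
      refine Prod.ext (funext fun i => ?_) (funext fun j => ?_)
      · rw [sum_arcPoint_fst, sum_arcPoint_fst]
        exact_mod_cast h1 i
      · rw [sum_arcPoint_snd, sum_arcPoint_snd]
        exact_mod_cast h2 j)
  exact funext fun a => Nat.cast_injective (congrFun this a)

open Classical in
/-- The finite set of all cyclic `(I, J̄)`-forests. -/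
noncomputable def cyclicForests {n : ℕ} (I J : Finset (Fin (n + 1))) : Finset (Finset (Arc n)) :=
  (I ×ˢ J).powerset.filter (IsCyclicForest I J)

theorem mem_cyclicForests {n : ℕ} {I J : Finset (Fin (n + 1))} {F : Finset (Arc n)} :
    F ∈ cyclicForests I J ↔ IsCyclicForest I J F := by
  simp only [cyclicForests, mem_filter, mem_powerset, and_iff_right_iff_imp]
  exact fun h => h.1

/-- The lattice points of `t • (Δ_I × Δ_J̄)` are counted by the positive weights of total `t` on
the cyclic forests. -/
theorem sum_card_weights_cyclicForests {n : ℕ} (I J : Finset (Fin (n + 1))) (t : ℕ) :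
    ∑ F ∈ cyclicForests I J, #{w ∈ F.piAntidiag t | ∀ a ∈ F, w a ≠ 0} =
      #(I.piAntidiag t) * #(J.piAntidiag t) := by
  rw [← Finset.card_product, ← Finset.card_sigma]
  -- Positivity on F makes F exactly the support of the weight, so the pair is determined by the
  -- weight alone.
  have supp : ∀ p : (_ : Finset (Arc n)) × (Arc n → ℕ),
      p ∈ (cyclicForests I J).sigma (fun F => {w ∈ F.piAntidiag t | ∀ a ∈ F, w a ≠ 0}) →
      IsCyclicForest I J p.1 ∧ (∀ a, p.2 a ≠ 0 ↔ a ∈ p.1) ∧ ∑ a, p.2 a = t := by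
    rintro ⟨F, w⟩ hp
    simp only [mem_sigma, mem_cyclicForests, mem_filter, mem_piAntidiag] at hp
    obtain ⟨hF, ⟨hs, h1⟩, h2⟩ := hp
    refine ⟨hF, fun a => ⟨h1 a, h2 a⟩, ?_⟩
    rw [← hs]
    exact (Finset.sum_subset (subset_univ F) fun a _ ha => by_contra fun h => ha (h1 a h)).symm
  -- Taking marginals is injective by `natWeights_unique` and surjective by `natWeights_exist`.
  refine Finset.card_bij (fun p _ => (fun i => ∑ j, p.2 (i, j), fun j => ∑ i, p.2 (i, j)))
    ?_ ?_ ?_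
  · intro p hp
    obtain ⟨hF, hs, ht⟩ := supp p hp
    rw [mem_product, mem_piAntidiag, mem_piAntidiag]
    have hI : ∀ i, ∑ j, p.2 (i, j) ≠ 0 → i ∈ I := fun i hi => by
      obtain ⟨j, -, hj⟩ := Finset.exists_ne_zero_of_sum_ne_zero hi
      exact (mem_product.1 (hF.1 ((hs _).1 hj))).1
    have hJ : ∀ j, ∑ i, p.2 (i, j) ≠ 0 → j ∈ J := fun j hj => by
      obtain ⟨i, -, hi⟩ := Finset.exists_ne_zero_of_sum_ne_zero hj
      exact (mem_product.1 (hF.1 ((hs _).1 hi))).2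
    refine ⟨⟨?_, hI⟩, ?_, hJ⟩
    · rw [Finset.sum_subset (subset_univ I) fun i _ hi => by_contra fun h => hi (hI i h),
        ← ht, Fintype.sum_prod_type]
    · rw [Finset.sum_subset (subset_univ J) fun j _ hj => by_contra fun h => hj (hJ j h),
        ← ht, Fintype.sum_prod_type_right]
  · rintro ⟨F, w⟩ hp ⟨G, u⟩ hq h
    obtain ⟨hF, hs, -⟩ := supp _ hp
    obtain ⟨hG, hs', -⟩ := supp _ hq
    dsimp only at hF hs hG hs' h
    rw [Prod.mk.injEq] at h
    obtain rfl : w = u := natWeights_unique w u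
      (fun a b ha hb => hF.2 a ((hs a).1 ha) b ((hs b).1 hb))
      (fun a b ha hb => hG.2 a ((hs' a).1 ha) b ((hs' b).1 hb))
      (fun i => congrFun h.1 i) (fun j => congrFun h.2 j)
    obtain rfl : F = G := by ext a; rw [← hs, hs']
    rfl
  · rintro ⟨r, c⟩ h
    simp only [mem_product, mem_piAntidiag] at h
    obtain ⟨⟨hr, hI⟩, hc, hJ⟩ := h
    rw [Finset.sum_subset (subset_univ I) fun i _ hi => by_contra fun h => hi (hI i h)] at hr
    rw [Finset.sum_subset (subset_univ J) fun i _ hi => by_contra fun h => hi (hJ i h)] at hc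
    obtain ⟨w, ws, wc, wr, wcol⟩ := natWeights_exist t r c hr hc
    refine ⟨⟨Finset.univ.filter fun a => w a ≠ 0, w⟩, ?_,
      Prod.ext (funext wr) (funext wcol)⟩
    simp only [mem_sigma, mem_cyclicForests, mem_filter, mem_piAntidiag, mem_univ, true_and,
      imp_self, implies_true, and_true]
    refine ⟨⟨fun a ha => ?_, fun a ha b hb => wc a b (by simpa using ha) (by simpa using hb)⟩, ?_⟩
    · obtain ⟨h1, h2⟩ := ws a (by simpa using ha)
      exact mem_product.2 ⟨hI _ h1, hJ _ h2⟩
    · rw [Finset.sum_filter_ne_zero, Fintype.sum_prod_type, Finset.sum_congr rfl fun i _ => wr i,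
        hr]

/-! ### The Ehrhart series -/

section Series

open PowerSeries

/-- Used with two choices of `g`: the constant 1 counts all weights on `s`, and the indicator of
nonzero numbers counts those positive on all of `s`. -/
theorem PowerSeries.coeff_mk_pow_card {R ι : Type*} [CommSemiring R] [DecidableEq ι]
    (s : Finset ι) (g : ℕ → R) (t : ℕ) :
    coeff t (PowerSeries.mk g ^ #s) = ∑ w ∈ s.piAntidiag t, ∏ i ∈ s, g (w i) := by
  rw [← Finset.prod_const, PowerSeries.coeff_prod]
  simp only [coeff_mk]
  refine Finset.sum_bij (fun l _ => l) ?_ ?_ ?_ ?_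
  · intro l hl
    rw [mem_finsuppAntidiag] at hl
    exact mem_piAntidiag.2 ⟨hl.1, fun i hi => hl.2 (Finsupp.mem_support_iff.2 hi)⟩
  · intro l _ l' _ h
    exact DFunLike.coe_injective h
  · intro w hw
    rw [mem_piAntidiag] at hw
    refine ⟨Finsupp.onFinset s w hw.2, ?_, rfl⟩
    rw [mem_finsuppAntidiag]
    exact ⟨hw.1, Finsupp.support_onFinset_subset⟩
  · intro l _
    rfl

/-- Stars and bars, read off from the expansion of 1/(1-X)^#s. For empty `s` and `t > 0` the
truncated `#s - 1` would give 1 instead of 0. -/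
theorem Finset.card_piAntidiag_nat {ι : Type*} [DecidableEq ι] (s : Finset ι) (hs : s.Nonempty)
    (t : ℕ) : #(s.piAntidiag t) = (#s - 1 + t).choose (#s - 1) := by
  have h := PowerSeries.coeff_mk_pow_card s (1 : ℕ → ℤ) t
  obtain ⟨a, ha⟩ := Nat.exists_eq_succ_of_ne_zero hs.card_ne_zero
  rw [ha, Nat.succ_eq_add_one, PowerSeries.mk_one_pow_eq_mk_choose_add, coeff_mk] at h
  rw [ha, Nat.succ_eq_add_one, Nat.add_sub_cancel]
  simpa using h.symm

/-- The Ehrhart series of the product of an `a`-simplex and a `b`-simplex. -/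
theorem one_sub_X_pow_mul_mk_choose (a b : ℕ) :
    (1 - X : PowerSeries ℤ) ^ (a + b + 1) *
        PowerSeries.mk (fun t => ((a + t).choose a * (b + t).choose b : ℤ)) =
      PowerSeries.mk fun k => (a.choose k * b.choose k : ℤ) := by
  -- Passing from b to b + 1 multiplies the `t`-th coefficient by (b+1+t)/(b+1), so it acts on the
  -- series as (X d/dX + b + 1)/(b + 1). The induction step checks that the numerator transforms
  -- accordingly, with the factor b + 1 kept on the left to avoid division.
  induction b with
  | zero =>
    have h := PowerSeries.mk_one_pow_eq_mk_choose_add ℤ a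
    have e : (PowerSeries.mk fun k => (a.choose k * Nat.choose 0 k : ℤ)) = 1 := by
      ext k
      cases k <;> simp [PowerSeries.coeff_one]
    simp only [Nat.choose_zero_right, Nat.cast_one, mul_one, add_zero]
    rw [e, ← h, ← mul_pow, mul_comm, PowerSeries.mk_one_mul_one_sub_eq_one, one_pow]
  | succ b ih =>
    set H : PowerSeries ℤ := PowerSeries.mk fun t => ((a + t).choose a * (b + t).choose b : ℤ)
      with hH
    set Q : PowerSeries ℤ := PowerSeries.mk fun k => (a.choose k * b.choose k : ℤ) with hQ
    have hb : ((b + 1 : ℤ)) ≠ 0 := by positivity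
    have step1 : (b + 1 : PowerSeries ℤ) * PowerSeries.mk
        (fun t => ((a + t).choose a * (b + 1 + t).choose (b + 1) : ℤ)) =
        X * d⁄dX ℤ H + (b + 1 : PowerSeries ℤ) * H := by
      have cst : (b + 1 : PowerSeries ℤ) = C ((b + 1 : ℕ) : ℤ) := by simp
      ext t
      rw [cst, map_add, coeff_C_mul, coeff_C_mul, coeff_mk, hH, coeff_mk]
      have key : ((b + 1 : ℤ)) * ((b + 1 + t).choose (b + 1) : ℤ) =
          (b + 1 + t) * ((b + t).choose b : ℤ) := by
        have := Nat.add_one_mul_choose_eq (b + t) b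
        rw [show b + t + 1 = b + 1 + t by ring] at this
        rw [mul_comm]
        exact_mod_cast this.symm
      have d : coeff t (X * d⁄dX ℤ (PowerSeries.mk
          fun t => ((a + t).choose a * (b + t).choose b : ℤ))) =
          t * ((a + t).choose a * (b + t).choose b : ℤ) := by
        cases t with
        | zero => simp
        | succ t =>
          rw [coeff_succ_X_mul, PowerSeries.coeff_derivative, coeff_mk]
          push_cast
          ring
      rw [d]
      push_cast
      linear_combination ((a + t).choose a : ℤ) * key
    -- The same operator, transported to the numerator Q = (1-X)^(a+b+1) H; coefficientwise it
    -- reduces to the absorption identities `h1`, `h2` and Pascal's rule.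
    have step2 : (b + 1 : PowerSeries ℤ) * PowerSeries.mk
        (fun k => (a.choose k * (b + 1).choose k : ℤ)) =
        (1 - X) * X * d⁄dX ℤ Q + (a + b + 1 : PowerSeries ℤ) * X * Q
          + (b + 1 : PowerSeries ℤ) * (1 - X) * Q := by
      have cst : (b + 1 : PowerSeries ℤ) = C ((b + 1 : ℕ) : ℤ) := by simp
      have e : (1 - X) * X * d⁄dX ℤ Q + (a + b + 1 : PowerSeries ℤ) * X * Q
          + (b + 1 : PowerSeries ℤ) * (1 - X) * Q =
          X * d⁄dX ℤ Q - X * (X * d⁄dX ℤ Q) + C (a : ℤ) * (X * Q) + C ((b + 1 : ℕ) : ℤ) * Q := by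
        rw [← cst, map_natCast]
        ring
      rw [e, cst]
      have d : ∀ k, coeff k (X * d⁄dX ℤ Q) = k * (a.choose k * b.choose k : ℤ) := by
        intro k
        cases k with
        | zero => simp
        | succ k =>
          rw [coeff_succ_X_mul, PowerSeries.coeff_derivative, hQ, coeff_mk]
          push_cast
          ring
      ext k
      cases k with
      | zero => simp [hQ]
      | succ k =>
        simp only [map_add, map_sub, coeff_C_mul, coeff_succ_X_mul, d]
        simp only [hQ, coeff_mk]
        -- The subtraction is in ℤ; for k > a both binomials vanish.
        have h1 : (a.choose (k + 1) : ℤ) * (k + 1) = a.choose k * (a - k) := by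
          rcases le_or_gt k a with h | h
          · have := Nat.choose_succ_right_eq a k
            rw [← Nat.cast_sub h]
            exact_mod_cast this
          · simp [Nat.choose_eq_zero_of_lt h, Nat.choose_eq_zero_of_lt (h.trans (Nat.lt_succ_self k))]
        have h2 : (b.choose (k + 1) : ℤ) * (k + 1) = b.choose k * (b - k) := by
          rcases le_or_gt k b with h | h
          · have := Nat.choose_succ_right_eq b k
            rw [← Nat.cast_sub h]
            exact_mod_cast this
          · simp [Nat.choose_eq_zero_of_lt h, Nat.choose_eq_zero_of_lt (h.trans (Nat.lt_succ_self k))]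
        rw [Nat.choose_succ_succ' b k]
        push_cast
        linear_combination ((b.choose k : ℤ)) * h1 - ((a.choose (k + 1) : ℤ)) * h2
    have hd : d⁄dX ℤ Q = (1 - X) ^ (a + b + 1) * d⁄dX ℤ H
        - (a + b + 1 : PowerSeries ℤ) * (1 - X) ^ (a + b) * H := by
      rw [← ih, Derivation.leibniz, PowerSeries.derivative_pow, map_sub,
        PowerSeries.derivative_one, PowerSeries.derivative_X]
      simp only [smul_eq_mul, Nat.add_sub_cancel]
      push_cast
      ring
    have hb' : (b + 1 : PowerSeries ℤ) ≠ 0 := fun h => by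
      have := congrArg PowerSeries.constantCoeff h
      simp only [map_add, map_natCast, map_one, map_zero] at this
      exact hb this
    refine mul_left_cancel₀ hb' ?_
    rw [step2, hd, ← ih, mul_left_comm, step1]
    ring

end Series

/-! ### Face numbers -/

namespace Geometry.SimplicialComplex

variable {E : Type*} [AddCommGroup E] [Module ℝ E]

/-- Finiteness matters because `rank` is an `sSup` in ℕ, which bounds the face sizes only when they
are bounded. -/
theorem numFaces_eq_zero_of_rank_lt (K : SimplicialComplex ℝ E) (hK : K.faces.Finite) {i : ℕ}
    (hi : K.rank < i) : K.numFaces i = 0 := by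
  have : {s : Finset E | (s = ∅ ∨ s ∈ K.faces) ∧ s.card = i} = ∅ := by
    refine Set.eq_empty_of_forall_notMem ?_
    rintro s ⟨rfl | hs, rfl⟩
    · simp at hi
    · exact hi.not_ge (le_csSup (hK.image _).bddAbove ⟨s, hs, rfl⟩)
  rw [numFaces, this, Set.ncard_empty]

theorem numFaces_rank_ne_zero (K : SimplicialComplex ℝ E) (hK : K.faces.Finite) :
    K.numFaces K.rank ≠ 0 := by
  have hfin : {s : Finset E | (s = ∅ ∨ s ∈ K.faces) ∧ s.card = K.rank}.Finite := by
    refine (hK.insert ∅).subset ?_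
    rintro s ⟨h, -⟩
    exact h
  rw [numFaces, Ne, Set.ncard_eq_zero hfin, ← Ne, ← Set.nonempty_iff_ne_empty]
  rcases K.faces.eq_empty_or_nonempty with h | h
  -- With no faces, `rank` is `sSup ∅ = 0`, and the empty face is the one counted.
  · exact ⟨∅, Or.inl rfl, by simp [rank, h]⟩
  · obtain ⟨s, hs, hc⟩ := Nat.sSup_mem (h.image Finset.card) (hK.image _).bddAbove
    exact ⟨s, Or.inr hs, hc⟩

open Polynomial in
/-- The generating polynomial of the `h`-vector, in the form
`∑ h_k X^k = ∑ f_{i-1} X^i (1-X)^(d-i)`. -/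
theorem coeff_sum_numFaces (K : SimplicialComplex ℝ E) (hK : K.faces.Finite) (k : ℕ) :
    (∑ i ∈ range (K.rank + 1), C (K.numFaces i : ℤ) * (X ^ i * (1 - X) ^ (K.rank - i))).coeff k =
      K.hVector k := by
  have hc : ∀ m j : ℕ, ((1 - X : ℤ[X]) ^ m).coeff j = (-1) ^ j * (m.choose j : ℤ) := by
    intro m j
    -- Substituting -X in the binomial theorem produces the signs.
    have e : (1 - X : ℤ[X]) = (1 + X).comp (C (-1) * X) := by simp [sub_eq_add_neg]
    rw [e, ← pow_comp, comp_C_mul_X_coeff, coeff_one_add_X_pow, mul_comm]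
  simp only [finsetSum_coeff, coeff_C_mul, coeff_X_pow_mul', hc, hVector]
  -- The two sums have different ranges, so both are extended to a common one: terms with i > rank
  -- vanish since there are no such faces, terms with i > k by the `if`.
  have h1 := Finset.sum_subset (range_mono (show K.rank + 1 ≤ K.rank + k + 1 by omega))
    (f := fun i => (K.numFaces i : ℤ) * if i ≤ k then
      (-1) ^ (k - i) * ((K.rank - i).choose (k - i) : ℤ) else 0) fun i _ hi => by
        rw [K.numFaces_eq_zero_of_rank_lt hK (by simpa using hi)]
        simp
  have h2 := Finset.sum_subset (range_mono (show k + 1 ≤ K.rank + k + 1 by omega))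
    (f := fun i => (K.numFaces i : ℤ) * if i ≤ k then
      (-1) ^ (k - i) * ((K.rank - i).choose (k - i) : ℤ) else 0) fun i _ hi => by
        rw [if_neg (by simpa using hi), mul_zero]
  rw [h1, ← h2]
  refine Finset.sum_congr rfl fun i hi => ?_
  rw [if_pos (by simpa [Nat.lt_succ_iff] using hi)]
  ring

end Geometry.SimplicialComplex

theorem IsCyclicForest.mono {n : ℕ} {I J : Finset (Fin (n + 1))} {F G : Finset (Arc n)}
    (hG : IsCyclicForest I J G) (h : F ⊆ G) : IsCyclicForest I J F :=
  ⟨h.trans hG.1, fun a ha b hb => hG.2 a (h ha) b (h hb)⟩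

-- Passage from geometry to combinatorics: subsets of trees are forests, and every forest extends to
-- a tree. Including the empty face matches the empty forest.
open Classical in
theorem eq_empty_or_mem_faces_cyclohedralTriangulation {n : ℕ} {I J : Finset (Fin (n + 1))}
    {s : Finset (ProdSpace n)} :
    s = ∅ ∨ s ∈ (cyclohedralTriangulation I J).faces ↔
      s ∈ (cyclicForests I J).image (Finset.image arcPoint) := by
  simp only [mem_image, mem_cyclicForests]
  constructor
  · rintro (rfl | ⟨-, T, hT, hs⟩)
    · exact ⟨∅, ⟨by simp, by simp⟩, by simp⟩
    · obtain ⟨F, hF, rfl⟩ := Finset.subset_set_image_iff.1 hs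
      exact ⟨F, hT.prop.mono (Finset.coe_subset.1 hF), rfl⟩
  · rintro ⟨F, hF, rfl⟩
    rcases F.eq_empty_or_nonempty with rfl | hne
    · simp
    · obtain ⟨T, hT, hFT⟩ := hF.exists_tree
      refine Or.inr ⟨hne.image _, T, hT, ?_⟩
      rw [Finset.coe_image]
      exact Set.image_mono (Finset.coe_subset.2 hFT)

theorem finite_faces_cyclohedralTriangulation {n : ℕ} (I J : Finset (Fin (n + 1))) :
    (cyclohedralTriangulation I J).faces.Finite := by
  classical
  refine ((cyclicForests I J).image (Finset.image arcPoint)).finite_toSet.subset fun s hs => ?_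
  exact eq_empty_or_mem_faces_cyclohedralTriangulation.1 (Or.inr hs)

theorem numFaces_cyclohedralTriangulation {n : ℕ} (I J : Finset (Fin (n + 1))) (i : ℕ) :
    (cyclohedralTriangulation I J).numFaces i = #{F ∈ cyclicForests I J | #F = i} := by
  classical
  have e : {s : Finset (ProdSpace n) |
      (s = ∅ ∨ s ∈ (cyclohedralTriangulation I J).faces) ∧ s.card = i} =
      Finset.image arcPoint '' ({F ∈ cyclicForests I J | #F = i} : Finset _) := by
    ext s
    rw [Set.mem_ofPred_eq, eq_empty_or_mem_faces_cyclohedralTriangulation]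
    simp only [mem_image, Set.mem_image, coe_filter, Set.mem_ofPred_eq]
    constructor
    · rintro ⟨⟨F, hF, rfl⟩, h⟩
      exact ⟨F, ⟨hF, by rwa [card_image_of_injective _ arcPoint_injective] at h⟩, rfl⟩
    · rintro ⟨F, ⟨hF, h⟩, rfl⟩
      exact ⟨⟨F, hF, rfl⟩, by rwa [card_image_of_injective _ arcPoint_injective]⟩
  rw [Geometry.SimplicialComplex.numFaces, e,
    Set.ncard_image_of_injective _ (Finset.image_injective arcPoint_injective),
    Set.ncard_coe_finset]

/-! ### The `h`-vector -/

open PowerSeries in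
/-- The Ehrhart series of `Δ_I × Δ_J̄` as a sum over the faces of the cyclohedral triangulation. -/
theorem sum_numFaces_mul_pow {n : ℕ} (I J : Finset (Fin (n + 1))) (hI : I.Nonempty)
    (hJ : J.Nonempty) :
    ∑ i ∈ range ((cyclohedralTriangulation I J).rank + 1),
        ((cyclohedralTriangulation I J).numFaces i : PowerSeries ℤ) *
          PowerSeries.mk (fun t => if t = 0 then 0 else (1 : ℤ)) ^ i =
      PowerSeries.mk fun t => ((#I - 1 + t).choose (#I - 1) * (#J - 1 + t).choose (#J - 1) : ℤ) := by
  set K := cyclohedralTriangulation I J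
  -- Y = X/(1-X), so the coefficients of Y^|F| count the weights positive on all of F.
  set Y : PowerSeries ℤ := PowerSeries.mk (fun t => if t = 0 then 0 else (1 : ℤ))
  have hfiber : ∑ i ∈ range (K.rank + 1), (K.numFaces i : PowerSeries ℤ) * Y ^ i =
      ∑ F ∈ cyclicForests I J, Y ^ #F := by
    rw [← Finset.sum_fiberwise_of_maps_to (s := cyclicForests I J) (t := range (K.rank + 1))
      (g := Finset.card)]
    · refine Finset.sum_congr rfl fun i _ => ?_
      rw [Finset.sum_congr rfl (g := fun _ => Y ^ i) fun F hF => by rw [(mem_filter.1 hF).2],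
        Finset.sum_const, nsmul_eq_mul, numFaces_cyclohedralTriangulation]
    -- No forest has more arcs than the rank, since it would be counted by a face number that is
    -- zero.
    · intro F hF
      by_contra h
      have := K.numFaces_eq_zero_of_rank_lt (finite_faces_cyclohedralTriangulation I J)
        (i := #F) (by simpa using h)
      rw [numFaces_cyclohedralTriangulation, Finset.card_eq_zero] at this
      exact Finset.notMem_empty F (this ▸ mem_filter.2 ⟨hF, rfl⟩)
  rw [hfiber]
  ext t
  rw [map_sum, coeff_mk, ← Nat.cast_mul, ← Finset.card_piAntidiag_nat I hI,
    ← Finset.card_piAntidiag_nat J hJ, ← sum_card_weights_cyclicForests, Nat.cast_sum]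
  refine Finset.sum_congr rfl fun F _ => ?_
  rw [PowerSeries.coeff_mk_pow_card, Finset.card_filter, Nat.cast_sum]
  refine Finset.sum_congr rfl fun w _ => ?_
  by_cases h : ∀ a ∈ F, w a ≠ 0
  · rw [if_pos h, Nat.cast_one]
    exact Finset.prod_eq_one fun a ha => if_neg (h a ha)
  · rw [if_neg h, Nat.cast_zero]
    push Not at h
    obtain ⟨a, ha, h0⟩ := h
    exact Finset.prod_eq_zero ha (if_pos h0)

open Polynomial in
theorem hVector_cyclohedralTriangulation {n : ℕ} (I J : Finset (Fin (n + 1))) (hI : I.Nonempty)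
    (hJ : J.Nonempty) (k : ℕ) :
    (cyclohedralTriangulation I J).hVector k =
      ((#I - 1).choose k * (#J - 1).choose k : ℕ) := by
  have hfin := finite_faces_cyclohedralTriangulation I J
  have hser := sum_numFaces_mul_pow I J hI hJ
  have hehr := one_sub_X_pow_mul_mk_choose (#I - 1) (#J - 1)
  rw [← hser] at hehr
  have hrank := Geometry.SimplicialComplex.numFaces_rank_ne_zero _ hfin
  rw [← Geometry.SimplicialComplex.coeff_sum_numFaces _ hfin]
  set K := cyclohedralTriangulation I J
  set a := #I - 1
  set b := #J - 1
  set P : ℤ[X] := ∑ i ∈ range (K.rank + 1),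
    C (K.numFaces i : ℤ) * (X ^ i * (1 - X) ^ (K.rank - i)) with hP
  set Q : ℤ[X] := ∑ i ∈ range (a + 1), C (a.choose i * b.choose i : ℤ) * X ^ i with hQ
  set Y : PowerSeries ℤ := PowerSeries.mk (fun t => if t = 0 then 0 else (1 : ℤ)) with hY
  have hQc : ∀ k, Q.coeff k = (a.choose k * b.choose k : ℤ) := by
    intro k
    simp only [hQ, finsetSum_coeff, coeff_C_mul_X_pow]
    rw [Finset.sum_ite_eq]
    split_ifs with h
    · rfl
    · rw [Nat.choose_eq_zero_of_lt (by simpa using h)]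
      simp
  have hYX : (1 - PowerSeries.X) * Y = PowerSeries.X := by
    have e : Y = PowerSeries.X * PowerSeries.mk 1 := by
      ext t
      cases t <;> simp [hY, PowerSeries.coeff_succ_X_mul]
    rw [e, mul_left_comm, mul_comm (1 - PowerSeries.X),
      PowerSeries.mk_one_mul_one_sub_eq_one, mul_one]
  have hPs : (P : PowerSeries ℤ) = (1 - PowerSeries.X) ^ K.rank *
      ∑ i ∈ range (K.rank + 1), (K.numFaces i : PowerSeries ℤ) * Y ^ i := by
    have : (P : PowerSeries ℤ) = ∑ i ∈ range (K.rank + 1), (K.numFaces i : PowerSeries ℤ) *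
        (PowerSeries.X ^ i * (1 - PowerSeries.X) ^ (K.rank - i)) := by
      rw [hP, ← coeToPowerSeries.ringHom_apply, map_sum]
      simp only [coeToPowerSeries.ringHom_apply, Polynomial.coe_mul, Polynomial.coe_C,
        Polynomial.coe_pow, Polynomial.coe_X, Polynomial.coe_sub, Polynomial.coe_one]
      simp only [map_natCast]
    rw [this, Finset.mul_sum]
    refine Finset.sum_congr rfl fun i hi => ?_
    have hi' : i ≤ K.rank := Nat.lt_succ_iff.1 (mem_range.1 hi)
    -- Writing X^i as (1-X)^i Y^i lets the power of 1-X combine to the exponent `K.rank`,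
    -- independent of i.
    nth_rw 1 [← hYX]
    rw [← Nat.sub_add_cancel hi', pow_add, Nat.add_sub_cancel, mul_pow]
    ring
  have hQs : (Q : PowerSeries ℤ) = PowerSeries.mk fun k => (a.choose k * b.choose k : ℤ) := by
    ext k
    rw [coeff_coe, hQc, PowerSeries.coeff_mk]
  -- Cross-multiplied form of the two expressions for the Ehrhart series, brought back to
  -- polynomials so that evaluation at 1 makes sense.
  have hPQ : P * (1 - X) ^ (a + b + 1) = Q * (1 - X) ^ K.rank := by
    refine Polynomial.coe_injective ℤ ?_
    push_cast
    rw [hPs, hQs, ← hehr]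
    ring
  -- At 1 only the term i = rank survives, leaving the number of faces of top dimension.
  have hP1 : P.eval 1 ≠ 0 := by
    rw [hP, eval_finsetSum, Finset.sum_range_succ, Finset.sum_eq_zero]
    · simpa using hrank
    · intro i hi
      have : K.rank - i ≠ 0 := Nat.sub_ne_zero_of_lt (mem_range.1 hi)
      simp [this]
  have hQ1 : Q.eval 1 ≠ 0 := by
    rw [hQ, eval_finsetSum, Finset.sum_range_succ']
    simp only [eval_mul, eval_C, eval_pow, eval_X, one_pow, mul_one, Nat.choose_zero_right,
      Nat.cast_one]
    positivity
  have hX : (1 - X : ℤ[X]) ≠ 0 := fun h => by simpa using congrArg (eval 0) h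
  -- Compare orders of vanishing at 1: if the exponents differed, cancelling the smaller power would
  -- leave a factor 1-X on one side and force P or Q to vanish at 1.
  have hR : K.rank = a + b + 1 := by
    rcases lt_trichotomy K.rank (a + b + 1) with h | h | h
    · obtain ⟨c, hc⟩ := Nat.exists_eq_add_of_lt h
      rw [hc, add_assoc, pow_add, mul_comm ((1 - X) ^ K.rank), ← mul_assoc] at hPQ
      have := congrArg (eval 1) (mul_right_cancel₀ (pow_ne_zero _ hX) hPQ)
      simp only [eval_mul, eval_pow, eval_sub, eval_one, eval_X, sub_self, ne_eq,
        Nat.add_one_ne_zero, not_false_eq_true, zero_pow, mul_zero] at this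
      exact absurd this.symm hQ1
    · exact h
    · obtain ⟨c, hc⟩ := Nat.exists_eq_add_of_lt h
      rw [hc, add_assoc (a + b + 1), pow_add _ (a + b + 1), mul_comm ((1 - X) ^ (a + b + 1)),
        ← mul_assoc] at hPQ
      have := congrArg (eval 1) (mul_right_cancel₀ (pow_ne_zero _ hX) hPQ)
      simp only [eval_mul, eval_pow, eval_sub, eval_one, eval_X, sub_self, ne_eq,
        Nat.add_one_ne_zero, not_false_eq_true, zero_pow, mul_zero] at this
      exact absurd this hP1
  rw [hR] at hPQ
  rw [mul_right_cancel₀ (pow_ne_zero _ hX) hPQ, hQc, Nat.cast_mul]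

theorem mainTheorem9 (n : ℕ) (I J : Finset (Fin (n + 1))) (hI : I.Nonempty) (hJ : J.Nonempty) :
    (∀ k : ℕ, (cyclohedralTriangulation I J).hVector k =
      ((I.card - 1).choose k * (J.card - 1).choose k : ℕ)) ∧
    (∀ m r : ℕ, I.card = m * r + 1 → J.card = r + 1 →
      ∀ k : ℕ, (cyclohedralTriangulation I J).hVector k =
        ((m * r).choose k * r.choose k : ℕ)) := by
  have h := hVector_cyclohedralTriangulation I J hI hJ
  refine ⟨h, fun m r hm hr k => ?_⟩
  rw [h, hm, hr, Nat.add_sub_cancel, Nat.add_sub_cancel]
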